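/- Let $\mathbb D$ be the open unit disc and $\mathbb T$ the unit circle. For $1\le p<\infty$ let $\mathcal H^p$ be the Hardy space of holomorphic functions $f$ on $\mathbb D$ with $\|f\|_p=\sup_{0\le r<1}\left(\int_0^{2\pi}|f(re^{i\theta})|^p\,\frac{d\theta}{2\pi}\right)^{1/p}<\infty$. For $\zeta\in\mathbb T$ and $\alpha>1$, the Stolz domain with vertex $\zeta$ and aperture $\alpha$ is $\Gamma(\zeta,\alpha)=\{z\in\mathbb D:\ |\zeta-z|<\alpha(1-|z|)\}$; a function on $\mathbb D$ has nontangential limit $l$ at $\zeta$ if it tends to $l$ as $z\to\zeta$ within $\Gamma(\zeta,\alpha)$, for every $\alpha>1$. Let $\varphi:\mathbb D\to\mathbb D$ be analytic, and let $E_\varphi$ be the set of $\zeta\in\mathbb T$ at which $\varphi$ has a finite angular derivative, that is, for which there is $\eta\in\mathbb T$ such that $\frac{\eta-\varphi(z)}{\zeta-z}$ has a finite nontangential limit at $\zeta$. Let $1\le p<\infty$, let $h\in\mathcal H^p$, and let $W_{h,\varphi}f=h\cdot(f\circ\varphi)$. Then: (i) If $W_{h,\varphi}$ is bounded on $\mathcal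 H^p$ (that is, it maps $\mathcal H^p$ into itself and is a bounded operator there), then $h$ is bounded on every Stolz domain whose vertex is a point of $E_\varphi$. (ii) If $W_{h,\varphi}$ is compact on $\mathcal H^p$, then $h(z)\to 0$ as $|z|\to1$ within any Stolz domain whose vertex is a point of $E_\varphi$. -/

import Mathlib

open Filter Topology MeasureTheory Set
open scoped ENNReal Real Complex.UnitDisc

noncomputable section

namespace WeightedComposition

/-! ### Holomorphic functions on the open unit disc `𝔻` -/

/-- The extension by zero to `ℂ` of a function on the open unit disc. -/
def zeroExt (f : 𝔻 → ℂ) : ℂ → ℂ := Function.extend (fun z : 𝔻 => (z : ℂ)) f 0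

/-- `f : 𝔻 → ℂ` is holomorphic. -/
def IsHolomorphic (f : 𝔻 → ℂ) : Prop := DifferentiableOn ℂ (zeroExt f) (Metric.ball 0 1)

theorem zeroExt_coe (f : 𝔻 → ℂ) (z : 𝔻) : zeroExt f (z : ℂ) = f z :=
  Complex.UnitDisc.coe_injective.extend_apply f 0 z

theorem zeroExt_zero : zeroExt 0 = 0 := by
  funext z
  by_cases hz : ∃ w : 𝔻, (w : ℂ) = z
  · obtain ⟨w, rfl⟩ := hz
    simp [zeroExt_coe]
  · simp [zeroExt, Function.extend_apply' _ _ _ hz]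

theorem zeroExt_add (f g : 𝔻 → ℂ) : zeroExt (f + g) = zeroExt f + zeroExt g := by
  funext z
  by_cases hz : ∃ w : 𝔻, (w : ℂ) = z
  · obtain ⟨w, rfl⟩ := hz
    simp [zeroExt_coe]
  · simp [zeroExt, Function.extend_apply' _ _ _ hz]

theorem zeroExt_smul (c : ℂ) (f : 𝔻 → ℂ) : zeroExt (c • f) = c • zeroExt f := by
  funext z
  by_cases hz : ∃ w : 𝔻, (w : ℂ) = z
  · obtain ⟨w, rfl⟩ := hz
    simp [zeroExt_coe]
  · simp [zeroExt, Function.extend_apply' _ _ _ hz]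

/-! ### The Hardy spaces `H^p`, `1 ≤ p ≤ ∞` -/

/-- The normalised arc length measure `dθ / 2π` on `(0, 2π]`. -/
def angleMeasure : Measure ℝ :=
  ENNReal.ofReal (2 * π)⁻¹ • volume.restrict (Ioc 0 (2 * π))

/-- The `p`-mean `(∫₀^{2π} |f(r e^{iθ})|^p dθ/2π)^{1/p}` of `f` over the circle of radius `r`. -/
def hardyMean (p : ℝ≥0∞) (f : 𝔻 → ℂ) (r : ℝ) : ℝ≥0∞ :=
  eLpNorm (fun θ : ℝ => zeroExt f (circleMap 0 r θ)) p angleMeasure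

/-- The extended Hardy norm `sup_{0 ≤ r < 1} (∫₀^{2π} |f(r e^{iθ})|^p dθ/2π)^{1/p}`. -/
def hardyENorm (p : ℝ≥0∞) (f : 𝔻 → ℂ) : ℝ≥0∞ :=
  ⨆ r : Ico (0 : ℝ) 1, hardyMean p f r

theorem continuous_circle {f : 𝔻 → ℂ} (hf : IsHolomorphic f) {r : ℝ} (hr : r ∈ Ico (0 : ℝ) 1) :
    Continuous (fun θ : ℝ => zeroExt f (circleMap 0 r θ)) :=
  hf.continuousOn.comp_continuous (continuous_circleMap 0 r) fun θ => by
    simp [abs_of_nonneg hr.1, hr.2]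

/-- For finite `p` the extended Hardy norm is given by the usual formula. -/
theorem hardyENorm_eq {p : ℝ≥0∞} (h1 : 1 ≤ p) (hp : p ≠ ∞) (f : 𝔻 → ℂ) :
    hardyENorm p f = (⨆ r : Ico (0 : ℝ) 1, ENNReal.ofReal (2 * π)⁻¹ *
      ∫⁻ θ in Ioc 0 (2 * π), ‖zeroExt f (circleMap 0 r θ)‖ₑ ^ p.toReal) ^ (1 / p.toReal) := by
  have hp0 : p ≠ 0 := (zero_lt_one.trans_le h1).ne'
  have hpos : 0 < 1 / p.toReal := one_div_pos.mpr (ENNReal.toReal_pos hp0 hp)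
  have := (ENNReal.orderIsoRpow (1 / p.toReal) hpos).map_iSup (fun r : Ico (0 : ℝ) 1 =>
    ENNReal.ofReal (2 * π)⁻¹ *
      ∫⁻ θ in Ioc 0 (2 * π), ‖zeroExt f (circleMap 0 r θ)‖ₑ ^ p.toReal)
  simp only [ENNReal.orderIsoRpow_apply] at this
  rw [this]
  unfold hardyENorm hardyMean angleMeasure
  congr 1
  funext r
  rw [eLpNorm_eq_lintegral_rpow_enorm_toReal hp0 hp, lintegral_smul_measure, smul_eq_mul]

theorem hardyENorm_add_le {p : ℝ≥0∞} (h1 : 1 ≤ p) {f g : 𝔻 → ℂ} (hf : IsHolomorphic f)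
    (hg : IsHolomorphic g) : hardyENorm p (f + g) ≤ hardyENorm p f + hardyENorm p g := by
  refine iSup_le fun r => ?_
  refine le_trans ?_ (add_le_add (le_iSup (fun r : Ico (0 : ℝ) 1 => hardyMean p f r) r)
    (le_iSup (fun r : Ico (0 : ℝ) 1 => hardyMean p g r) r))
  simp only [hardyMean, zeroExt_add]
  exact eLpNorm_add_le (continuous_circle hf r.2).aestronglyMeasurable
    (continuous_circle hg r.2).aestronglyMeasurable h1

theorem hardyENorm_smul (p : ℝ≥0∞) (c : ℂ) (f : 𝔻 → ℂ) :
    hardyENorm p (c • f) = ‖c‖ₑ * hardyENorm p f := by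
  unfold hardyENorm hardyMean
  rw [ENNReal.mul_iSup]
  congr 1
  funext r
  rw [zeroExt_smul]
  exact eLpNorm_const_smul c _ p _

theorem hardyENorm_zero (p : ℝ≥0∞) : hardyENorm p 0 = 0 := by
  simp [hardyENorm, hardyMean, zeroExt_zero]

theorem eq_zero_of_hardyENorm_eq_zero {p : ℝ≥0∞} (h1 : 1 ≤ p) {f : 𝔻 → ℂ}
    (hf : IsHolomorphic f) (h : hardyENorm p f = 0) : f = 0 := by
  funext z
  have hr : ‖(z : ℂ)‖ ∈ Ico (0 : ℝ) 1 := ⟨norm_nonneg _, z.norm_lt_one⟩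
  have hm : hardyMean p f ‖(z : ℂ)‖ = 0 := by
    have := le_iSup (fun r : Ico (0 : ℝ) 1 => hardyMean p f r) ⟨_, hr⟩
    exact le_antisymm (this.trans h.le) bot_le
  have hc := continuous_circle hf hr
  rw [hardyMean, eLpNorm_eq_zero_iff hc.aestronglyMeasurable (zero_lt_one.trans_le h1).ne',
    angleMeasure] at hm
  replace hm := (Measure.ae_ennreal_smul_measure_iff (by simp [Real.pi_pos])).1 hm
  have hm' := Measure.eqOn_Ioc_of_ae_eq volume hm hc.continuousOn
    continuous_zero.continuousOn
  have hz : (z : ℂ) ∈ circleMap 0 ‖(z : ℂ)‖ '' Ioc 0 (2 * π) := by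
    rw [image_circleMap_Ioc, abs_of_nonneg (norm_nonneg _)]
    simp
  obtain ⟨θ, hθ, hz⟩ := hz
  have := hm' hθ
  simp only [hz, zeroExt_coe] at this
  simpa using this

/-- The functions that make up `H^p`, as a subspace of all functions on the disc. -/
def hardySubmodule (p : ℝ≥0∞) [hp : Fact (1 ≤ p)] : Submodule ℂ (𝔻 → ℂ) where
  carrier := {f | IsHolomorphic f ∧ hardyENorm p f < ∞}
  zero_mem' := ⟨by simp [IsHolomorphic, zeroExt_zero],
    by simp [hardyENorm_zero]⟩
  add_mem' {f g} hf hg := ⟨by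
    simpa [IsHolomorphic, zeroExt_add] using hf.1.add hg.1,
    (hardyENorm_add_le hp.out hf.1 hg.1).trans_lt (ENNReal.add_lt_top.2 ⟨hf.2, hg.2⟩)⟩
  smul_mem' c f hf := ⟨by
    simpa [IsHolomorphic, zeroExt_smul] using hf.1.const_smul c, by
    rw [hardyENorm_smul]; exact ENNReal.mul_lt_top enorm_lt_top hf.2⟩

/-- The Hardy space `H^p` of the unit disc. This is a type of its own, so that its only topology
is that of the Hardy norm, not that of pointwise convergence. -/
def HardySpace (p : ℝ≥0∞) [Fact (1 ≤ p)] : Type := hardySubmodule p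

variable (p : ℝ≥0∞) [Fact (1 ≤ p)]

instance : AddCommGroup (HardySpace p) := inferInstanceAs (AddCommGroup (hardySubmodule p))

instance : Module ℂ (HardySpace p) := inferInstanceAs (Module ℂ (hardySubmodule p))

instance : CoeFun (HardySpace p) (fun _ => 𝔻 → ℂ) := ⟨Subtype.val⟩

instance : Norm (HardySpace p) := ⟨fun f => (hardyENorm p f).toReal⟩

theorem hardySpace_core : NormedSpace.Core ℂ (HardySpace p) where
  norm_nonneg _ := ENNReal.toReal_nonneg
  norm_smul c f := by
    change (hardyENorm p (c • f.1)).toReal = ‖c‖ * (hardyENorm p f.1).toReal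
    rw [hardyENorm_smul, ENNReal.toReal_mul, toReal_enorm]
  norm_triangle f g := by
    change (hardyENorm p (f.1 + g.1)).toReal ≤
      (hardyENorm p f.1).toReal + (hardyENorm p g.1).toReal
    rw [← ENNReal.toReal_add f.2.2.ne g.2.2.ne]
    exact ENNReal.toReal_mono (ENNReal.add_ne_top.2 ⟨f.2.2.ne, g.2.2.ne⟩)
      (hardyENorm_add_le Fact.out f.2.1 g.2.1)
  norm_eq_zero_iff f := by
    change (hardyENorm p f.1).toReal = 0 ↔ f = 0
    constructor
    · intro h
      rw [ENNReal.toReal_eq_zero_iff, or_iff_left f.2.2.ne] at h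
      exact Subtype.ext (eq_zero_of_hardyENorm_eq_zero Fact.out f.2.1 h)
    · rintro rfl
      change (hardyENorm p 0).toReal = 0
      simp [hardyENorm_zero]

instance : NormedAddCommGroup (HardySpace p) := NormedAddCommGroup.ofCore (hardySpace_core p)

instance : NormedSpace ℂ (HardySpace p) := NormedSpace.ofCore (hardySpace_core p)

/-! ### Weighted composition operators -/

/-- The weighted composition operator `f ↦ h · (f ∘ φ)` on arbitrary functions on the disc. -/
def weightedComp (h : 𝔻 → ℂ) (φ : 𝔻 → 𝔻) : (𝔻 → ℂ) →ₗ[ℂ] (𝔻 → ℂ) where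
  toFun f := fun z => h z * f (φ z)
  map_add' f g := by funext z; simp [mul_add]
  map_smul' c f := by funext z; simp [mul_left_comm]

/-- `W_{h,φ}` maps `H^p` to itself and is a bounded operator there. -/
def IsBoundedOnHardy (h : 𝔻 → ℂ) (φ : 𝔻 → 𝔻) : Prop :=
  ∃ T : HardySpace p →L[ℂ] HardySpace p,
    ∀ f : HardySpace p, (T f : 𝔻 → ℂ) = weightedComp h φ f

/-- `W_{h,φ}` maps `H^p` to itself and is a compact operator there. -/
def IsCompactOnHardy (h : 𝔻 → ℂ) (φ : 𝔻 → 𝔻) : Prop :=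
  ∃ T : HardySpace p →L[ℂ] HardySpace p,
    (∀ f : HardySpace p, (T f : 𝔻 → ℂ) = weightedComp h φ f) ∧ IsCompactOperator T

/-! ### Stolz domains and angular derivatives -/

/-- The Stolz domain `{z ∈ 𝔻 : |ζ - z| < α (1 - |z|)}` with vertex `ζ` on the unit circle and
aperture `α` (relevant for `α > 1`, empty otherwise). -/
def stolzDomain (ζ : Circle) (α : ℝ) : Set 𝔻 :=
  {z | ‖(ζ : ℂ) - (z : ℂ)‖ < α * (1 - ‖(z : ℂ)‖)}

/-- For the vertex `1` this is Mathlib's Stolz set. -/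
theorem mem_stolzDomain_one (α : ℝ) (z : 𝔻) :
    z ∈ stolzDomain 1 α ↔ (z : ℂ) ∈ Complex.stolzSet α := by
  simp [stolzDomain, Complex.stolzSet, z.norm_lt_one]

/-- `g` has the nontangential limit `l` at `ζ`: `g z → l` as `z → ζ` within each Stolz domain
with vertex `ζ`. -/
def HasNontangentialLimit (g : 𝔻 → ℂ) (ζ : Circle) (l : ℂ) : Prop :=
  ∀ α : ℝ, 1 < α →
    Tendsto g (comap (fun z : 𝔻 => (z : ℂ)) (𝓝 (ζ : ℂ)) ⊓ 𝓟 (stolzDomain ζ α)) (𝓝 l)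

/-- `φ` has a finite angular derivative at `ζ`: for some `η` on the unit circle, the difference
quotient `(η - φ z) / (ζ - z)` has a finite nontangential limit at `ζ`. -/
def HasFiniteAngularDerivative (φ : 𝔻 → 𝔻) (ζ : Circle) : Prop :=
  ∃ (η : Circle) (l : ℂ),
    HasNontangentialLimit (fun z => ((η : ℂ) - (φ z : ℂ)) / ((ζ : ℂ) - (z : ℂ))) ζ l

/-- The set `E_φ` of points of the circle at which `φ` has a finite angular derivative. -/
def angularDerivativeSet (φ : 𝔻 → 𝔻) : Set Circle := {ζ | HasFiniteAngularDerivative φ ζ}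

end WeightedComposition

end

namespace WeightedComposition

open Real Complex ComplexConjugate

/-! The operator `T` is tested on k_w(u) = ((1 - |w|²)/(1 - w̄u)²)^{1/p} with w = φ(z). By
`hardyENorm_kernelPower_le`, k_w lies in the unit ball, while |k_w(w)| = (1 - |w|²)^{-1/p}.
Evaluation at z has norm at most (4/(1 - |z|))^{1/p} (`norm_apply_le`). Applied to T k_w, whose
value at z is h(z) k_w(w), this gives |h(z)| ≤ (8(1 - |φ(z)|)/(1 - |z|))^{1/p} ‖T k_{φ(z)}‖
(`norm_weight_le`).

In a Stolz domain at a point of E_φ, near the vertex, the angular derivative bounds the quotient,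
since 1 - |φ(z)| ≤ |η - φ(z)| ≤ M(1 - |z|). Hence |h(z)| is at most a constant times ‖T k_{φ(z)}‖.
Boundedness of `T` gives (i). For (ii), φ(z) → η, so k_{φ(z)} → 0 pointwise, and compactness turns
this into ‖T k_{φ(z)}‖ → 0. -/

/-! ### Poisson kernel and point evaluations. -/

theorem circleAverage_eq_integral_angleMeasure (F : ℂ → ℂ) (R : ℝ) :
    circleAverage F 0 R = ∫ θ, F (circleMap 0 R θ) ∂angleMeasure := by
  rw [circleAverage_def, angleMeasure, integral_smul_measure,
    intervalIntegral.integral_of_le Real.two_pi_pos.le,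
    ENNReal.toReal_ofReal (by positivity)]

instance : IsFiniteMeasure angleMeasure :=
  ⟨by simp [angleMeasure, ENNReal.mul_lt_top_iff]⟩

theorem poissonKernel_nonneg {R : ℝ} {w : ℂ} (hw : ‖w‖ < R) (θ : ℝ) :
    0 ≤ poissonKernel 0 w (circleMap 0 R θ) := by
  have hR : 0 < R := (norm_nonneg w).trans_lt hw
  have := pow_le_pow_left₀ (norm_nonneg w) hw.le 2
  rw [poissonKernel_def]
  simp only [sub_zero, norm_circleMap_zero, sq_abs]
  exact div_nonneg (by linarith) (by positivity)

theorem poissonKernel_le {R : ℝ} {w : ℂ} (hw : ‖w‖ < R) (θ : ℝ) :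
    poissonKernel 0 w (circleMap 0 R θ) ≤ (R + ‖w‖) / (R - ‖w‖) := by
  have hR : 0 < R := (norm_nonneg w).trans_lt hw
  rw [poissonKernel_eq_re_herglotzRieszKernel]
  simpa [herglotzRieszKernel] using re_herglotzRieszKernel_le (c := 0) (R := R)
    (circleMap_mem_sphere 0 hR.le θ) (w := w) (by simpa using hw)

theorem continuous_poissonKernel_circleMap {R : ℝ} {w : ℂ} (hw : ‖w‖ < R) :
    Continuous fun θ : ℝ => poissonKernel 0 w (circleMap 0 R θ) := by
  have hR : 0 < R := (norm_nonneg w).trans_lt hw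
  simp only [poissonKernel_def, sub_zero]
  refine Continuous.div (by fun_prop) (by fun_prop) fun θ h0 => ?_
  have h1 : circleMap 0 R θ = w := by
    simpa [sub_eq_zero] using h0
  have h2 := norm_circleMap_zero R θ
  rw [h1, abs_of_pos hR] at h2
  exact hw.ne h2

/-- Poisson's formula for the constant 1. It serves both the bound on point evaluations and the norm
of the test functions. -/
theorem lintegral_poissonKernel {R : ℝ} {w : ℂ} (hw : ‖w‖ < R) :
    ∫⁻ θ, ENNReal.ofReal (poissonKernel 0 w (circleMap 0 R θ)) ∂angleMeasure = 1 := by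
  have hc := continuous_poissonKernel_circleMap hw
  have hint : Integrable (fun θ => poissonKernel 0 w (circleMap 0 R θ)) angleMeasure := by
    refine Integrable.of_bound hc.aestronglyMeasurable ((R + ‖w‖) / (R - ‖w‖))
      (Eventually.of_forall fun θ => ?_)
    rw [Real.norm_of_nonneg (poissonKernel_nonneg hw θ)]
    exact poissonKernel_le hw θ
  rw [← ofReal_integral_eq_lintegral_ofReal hint
    (Eventually.of_forall (poissonKernel_nonneg hw))]
  have h1 := DiffContOnCl.circleAverage_poissonKernel_smul (f := fun _ => (1 : ℂ)) (c := 0)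
    (R := R) (w := w) diffContOnCl_const (by simpa using hw)
  rw [circleAverage_eq_integral_angleMeasure] at h1
  have h2 : ((∫ θ, poissonKernel 0 w (circleMap 0 R θ) ∂angleMeasure : ℝ) : ℂ) = 1 := by
    rw [← h1, ← integral_complex_ofReal]
    simp
  rw [Complex.ofReal_eq_one.1 h2, ENNReal.ofReal_one]

/-- Point evaluations are controlled by the mean over any larger circle. -/
theorem enorm_apply_le_hardyMean {p : ℝ≥0∞} (h1 : 1 ≤ p) (hp : p ≠ ∞) {f : 𝔻 → ℂ}
    (hf : IsHolomorphic f) {z : 𝔻} {R : ℝ} (hz : ‖(z : ℂ)‖ < R) (hR : R < 1) :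
    ‖f z‖ₑ ≤ ENNReal.ofReal ((R + ‖(z : ℂ)‖) / (R - ‖(z : ℂ)‖)) ^ (1 / p.toReal) *
      hardyMean p f R := by
  have hR0 : 0 < R := (norm_nonneg _).trans_lt hz
  set P : ℝ → ℝ := fun θ => poissonKernel 0 (z : ℂ) (circleMap 0 R θ) with hP
  have hPc : Continuous P := continuous_poissonKernel_circleMap hz
  have hPm : Measurable fun θ => ENNReal.ofReal (P θ) := hPc.measurable.ennreal_ofReal
  have hF := continuous_circle hf ⟨hR0.le, hR⟩
  -- As `ν` is a probability measure, passing from exponent 1 to `p` costs nothing; the maximum of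
  -- the Poisson kernel then enters only to the power 1/p.
  set ν := angleMeasure.withDensity fun θ => ENNReal.ofReal (P θ) with hν
  have : IsProbabilityMeasure ν :=
    ⟨by rw [hν, withDensity_apply _ MeasurableSet.univ, Measure.restrict_univ,
      lintegral_poissonKernel hz]⟩
  have hle : ν ≤ ENNReal.ofReal ((R + ‖(z : ℂ)‖) / (R - ‖(z : ℂ)‖)) • angleMeasure := by
    rw [← withDensity_const]
    exact withDensity_mono (Eventually.of_forall fun θ =>
      ENNReal.ofReal_le_ofReal (poissonKernel_le hz θ))
  have hd : DiffContOnCl ℂ (zeroExt f) (Metric.ball 0 R) := by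
    refine DifferentiableOn.diffContOnCl (hf.mono ?_)
    rw [closure_ball _ hR0.ne']
    exact Metric.closedBall_subset_ball hR
  have hval := hd.circleAverage_poissonKernel_smul (w := (z : ℂ)) (by simpa using hz)
  rw [circleAverage_eq_integral_angleMeasure, zeroExt_coe] at hval
  calc ‖f z‖ₑ ≤ ∫⁻ θ, ‖P θ • zeroExt f (circleMap 0 R θ)‖ₑ ∂angleMeasure := by
        rw [← hval]; exact enorm_integral_le_lintegral_enorm _
    _ = ∫⁻ θ, ‖zeroExt f (circleMap 0 R θ)‖ₑ ∂ν := by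
        rw [hν, lintegral_withDensity_eq_lintegral_mul _ hPm hF.enorm.measurable]
        refine lintegral_congr fun θ => ?_
        rw [enorm_smul, Pi.mul_apply, Real.enorm_of_nonneg (poissonKernel_nonneg hz θ)]
    _ = eLpNorm (fun θ => zeroExt f (circleMap 0 R θ)) 1 ν :=
        eLpNorm_one_eq_lintegral_enorm.symm
    _ ≤ eLpNorm (fun θ => zeroExt f (circleMap 0 R θ)) p ν :=
        eLpNorm_le_eLpNorm_of_exponent_le h1 hF.aestronglyMeasurable
    _ ≤ _ := eLpNorm_mono_measure _ hle
    _ = _ := by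
        rw [eLpNorm_smul_measure_of_ne_top hp, smul_eq_mul, hardyMean, ENNReal.toReal_div,
          ENNReal.toReal_one]

theorem norm_apply_le {p : ℝ≥0∞} [Fact (1 ≤ p)] (hp : p ≠ ∞) (f : HardySpace p) (z : 𝔻) :
    ‖f z‖ ≤ (4 / (1 - ‖(z : ℂ)‖)) ^ (1 / p.toReal) * ‖f‖ := by
  have hz := z.norm_lt_one
  -- The radius R is midway between |z| and 1, so R - |z| = (1 - |z|)/2 and R + |z| ≤ 2, whence the
  -- 4.
  have hR : (1 + ‖(z : ℂ)‖) / 2 ∈ Ico (0 : ℝ) 1 :=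
    ⟨by positivity, by linarith⟩
  have key := enorm_apply_le_hardyMean Fact.out hp f.2.1 (z := z)
    (R := (1 + ‖(z : ℂ)‖) / 2) (by linarith) hR.2
  have hmean : hardyMean p f.1 ((1 + ‖(z : ℂ)‖) / 2) ≤ hardyENorm p f.1 :=
    le_iSup (fun r : Ico (0 : ℝ) 1 => hardyMean p f.1 r) ⟨_, hR⟩
  have hq : 0 ≤ 1 / p.toReal := by positivity
  have hfrac : ((1 + ‖(z : ℂ)‖) / 2 + ‖(z : ℂ)‖) / ((1 + ‖(z : ℂ)‖) / 2 - ‖(z : ℂ)‖) ≤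
      4 / (1 - ‖(z : ℂ)‖) := by
    rw [div_le_div_iff₀ (by linarith) (by linarith)]
    nlinarith
  have h4 : 0 ≤ 4 / (1 - ‖(z : ℂ)‖) := div_nonneg (by norm_num) (by linarith)
  have := key.trans (mul_le_mul'
    (ENNReal.rpow_le_rpow (ENNReal.ofReal_le_ofReal hfrac) hq) hmean)
  rw [ENNReal.ofReal_rpow_of_nonneg h4 hq] at this
  have h5 := ENNReal.toReal_mono (ENNReal.mul_ne_top ENNReal.ofReal_ne_top f.2.2.ne) this
  rwa [toReal_enorm, ENNReal.toReal_mul, ENNReal.toReal_ofReal (Real.rpow_nonneg h4 _)] at h5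

/-! ### Test functions and the pointwise bound on the weight. -/

/-- The normalised power `((1 - |w|²) / (1 - w̄ u)²)^{1/p}` of the Szegő kernel at `w`. -/
noncomputable def kernelPower (p : ℝ≥0∞) (w : 𝔻) : 𝔻 → ℂ := fun u =>
  (((1 - ‖(w : ℂ)‖ ^ 2) ^ (1 / p.toReal) : ℝ) : ℂ) *
    (1 - conj (w : ℂ) * u) ^ ((-(2 / p.toReal) : ℝ) : ℂ)

/-- Keeps the base in the slit plane, where the principal power is holomorphic. -/
theorem re_one_sub_conj_mul_pos {w u : ℂ} (hw : ‖w‖ < 1) (hu : ‖u‖ < 1) :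
    0 < (1 - conj w * u).re := by
  have h1 : ‖conj w * u‖ < 1 := by
    rw [norm_mul, RCLike.norm_conj]
    exact mul_lt_one_of_nonneg_of_lt_one_left (norm_nonneg _) hw hu.le
  have := (Complex.re_le_norm (conj w * u)).trans_lt h1
  rw [Complex.sub_re, Complex.one_re]
  linarith

theorem isHolomorphic_kernelPower (p : ℝ≥0∞) (w : 𝔻) : IsHolomorphic (kernelPower p w) := by
  have : DifferentiableOn ℂ (fun u : ℂ => (((1 - ‖(w : ℂ)‖ ^ 2) ^ (1 / p.toReal) : ℝ) : ℂ) *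
      (1 - conj (w : ℂ) * u) ^ ((-(2 / p.toReal) : ℝ) : ℂ)) (Metric.ball 0 1) := by
    refine DifferentiableOn.const_mul ?_ _
    refine DifferentiableOn.cpow_const (by fun_prop) fun u hu => Or.inl ?_
    exact re_one_sub_conj_mul_pos w.norm_lt_one (by simpa using hu)
  refine this.congr fun u hu => ?_
  have hu' : ‖u‖ < 1 := by simpa using hu
  exact zeroExt_coe (kernelPower p w) (Complex.UnitDisc.mk u hu')

theorem norm_kernelPower (p : ℝ≥0∞) (w u : 𝔻) : ‖kernelPower p w u‖ =
    ((1 - ‖(w : ℂ)‖ ^ 2) / ‖1 - conj (w : ℂ) * u‖ ^ 2) ^ (1 / p.toReal) := by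
  have hw : 0 ≤ 1 - ‖(w : ℂ)‖ ^ 2 := by
    have := pow_le_one₀ (n := 2) (norm_nonneg _) w.norm_lt_one.le
    linarith
  rw [kernelPower, norm_mul, Complex.norm_cpow_real, Complex.norm_real,
    Real.norm_of_nonneg (Real.rpow_nonneg hw _), Real.div_rpow hw (by positivity),
    Real.rpow_neg (norm_nonneg _), div_eq_mul_inv, ← Real.rpow_natCast ‖1 - _‖ 2,
    ← Real.rpow_mul (norm_nonneg _)]
  congr 4
  push_cast
  ring

/-- On the circle of radius r, |k_w|^p = (1 - |w|²)/|e^{iθ} - rw|², which is at most the Poisson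
kernel of the unit disc at rw, of mean 1. -/
theorem hardyENorm_kernelPower_le {p : ℝ≥0∞} (h1 : 1 ≤ p) (hp : p ≠ ∞) (w : 𝔻) :
    hardyENorm p (kernelPower p w) ≤ 1 := by
  refine iSup_le fun ⟨r, hr⟩ => ?_
  have hp0 : p ≠ 0 := (zero_lt_one.trans_le h1).ne'
  have hpos : 0 < p.toReal := ENNReal.toReal_pos hp0 hp
  rw [hardyMean, eLpNorm_eq_lintegral_rpow_enorm_toReal hp0 hp]
  refine ENNReal.rpow_le_one ?_ (by positivity)
  have ha : ‖(r : ℂ) * (w : ℂ)‖ < 1 := by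
    rw [norm_mul, Complex.norm_real, Real.norm_of_nonneg hr.1]
    exact mul_lt_one_of_nonneg_of_lt_one_left hr.1 hr.2 w.norm_lt_one.le
  rw [← lintegral_poissonKernel ha]
  refine lintegral_mono fun θ => ?_
  have hmem : ‖circleMap 0 r θ‖ < 1 := by simpa [abs_of_nonneg hr.1] using hr.2
  have hnorm : ‖1 - conj (w : ℂ) * circleMap 0 r θ‖ = ‖circleMap 0 1 θ - r * w‖ := by
    have hunit : conj (circleMap 0 1 θ) * circleMap 0 1 θ = 1 := by
      rw [mul_comm, Complex.mul_conj, Complex.normSq_eq_norm_sq]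
      simp
    have hmul : circleMap 0 r θ = r * circleMap 0 1 θ := by simp [circleMap]
    have : 1 - conj (w : ℂ) * circleMap 0 r θ =
        conj (circleMap 0 1 θ - r * w) * circleMap 0 1 θ := by
      rw [map_sub, sub_mul, hunit, hmul, map_mul, Complex.conj_ofReal]
      ring
    rw [this, norm_mul, RCLike.norm_conj]
    simp
  have hval : zeroExt (kernelPower p w) (circleMap 0 r θ) =
      kernelPower p w (Complex.UnitDisc.mk _ hmem) :=
    zeroExt_coe (kernelPower p w) (Complex.UnitDisc.mk _ hmem)
  have hw : 0 ≤ 1 - ‖(w : ℂ)‖ ^ 2 := by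
    have := pow_le_one₀ (n := 2) (norm_nonneg _) w.norm_lt_one.le
    linarith
  rw [hval, ← ofReal_norm, ENNReal.ofReal_rpow_of_nonneg (norm_nonneg _) hpos.le,
    norm_kernelPower, ← Real.rpow_mul (by positivity), one_div_mul_cancel hpos.ne',
    Real.rpow_one]
  refine ENNReal.ofReal_le_ofReal ?_
  simp only [Complex.UnitDisc.coe_mk, hnorm, poissonKernel_def, sub_zero, norm_circleMap_zero,
    abs_one, one_pow, norm_mul, Complex.norm_real, Real.norm_of_nonneg hr.1]
  have hle : r * ‖(w : ℂ)‖ ≤ ‖(w : ℂ)‖ := mul_le_of_le_one_left (norm_nonneg _) hr.2.le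
  have hle0 : 0 ≤ r * ‖(w : ℂ)‖ := mul_nonneg hr.1 (norm_nonneg _)
  gcongr

/-- `kernelPower p w` as an element of the unit ball of `H^p`. -/
noncomputable def hardyKernel (p : ℝ≥0∞) [Fact (1 ≤ p)] (hp : p ≠ ∞) (w : 𝔻) : HardySpace p :=
  ⟨kernelPower p w, isHolomorphic_kernelPower p w,
    (hardyENorm_kernelPower_le Fact.out hp w).trans_lt ENNReal.one_lt_top⟩

theorem norm_hardyKernel_le {p : ℝ≥0∞} [Fact (1 ≤ p)] (hp : p ≠ ∞) (w : 𝔻) :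
    ‖hardyKernel p hp w‖ ≤ 1 :=
  ENNReal.toReal_mono ENNReal.one_ne_top (hardyENorm_kernelPower_le Fact.out hp w)

/-- The weight is controlled by the action of the operator on the kernel at `φ z`. -/
theorem norm_weight_le {p : ℝ≥0∞} [Fact (1 ≤ p)] (hp : p ≠ ∞) {h : 𝔻 → ℂ} {φ : 𝔻 → 𝔻}
    {T : HardySpace p →L[ℂ] HardySpace p}
    (hT : ∀ f : HardySpace p, (T f : 𝔻 → ℂ) = weightedComp h φ f) (z : 𝔻) :
    ‖h z‖ ≤ (8 * ((1 - ‖(φ z : ℂ)‖) / (1 - ‖(z : ℂ)‖))) ^ (1 / p.toReal) *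
      ‖T (hardyKernel p hp (φ z))‖ := by
  have hz : 0 < 1 - ‖(z : ℂ)‖ := sub_pos.2 z.norm_lt_one
  have hw1 := (φ z).norm_lt_one
  have hw0 := norm_nonneg (φ z : ℂ)
  have hw : 0 < 1 - ‖(φ z : ℂ)‖ ^ 2 := by nlinarith
  have hq : 0 ≤ 1 / p.toReal := by positivity
  have key := norm_apply_le hp (T (hardyKernel p hp (φ z))) z
  have hval : (T (hardyKernel p hp (φ z)) : 𝔻 → ℂ) z = h z * kernelPower p (φ z) (φ z) := by
    rw [hT]; rfl
  have hker : ‖kernelPower p (φ z) (φ z)‖ = (1 / (1 - ‖(φ z : ℂ)‖ ^ 2)) ^ (1 / p.toReal) := by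
    rw [norm_kernelPower, mul_comm, Complex.mul_conj, Complex.normSq_eq_norm_sq]
    have : ‖(1 : ℂ) - ((‖(φ z : ℂ)‖ ^ 2 : ℝ) : ℂ)‖ = 1 - ‖(φ z : ℂ)‖ ^ 2 := by
      rw [← Complex.ofReal_one, ← Complex.ofReal_sub, Complex.norm_real,
        Real.norm_of_nonneg hw.le]
    rw [this]
    congr 1
    field_simp
  rw [hval, norm_mul, hker] at key
  have hpos : 0 < (1 / (1 - ‖(φ z : ℂ)‖ ^ 2)) ^ (1 / p.toReal) :=
    Real.rpow_pos_of_pos (by positivity) _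
  -- The 8 is 4 · 2, from 1 - |w|² ≤ 2(1 - |w|) with w = φ(z).
  have hle : (4 / (1 - ‖(z : ℂ)‖)) ^ (1 / p.toReal) ≤
      (8 * ((1 - ‖(φ z : ℂ)‖) / (1 - ‖(z : ℂ)‖))) ^ (1 / p.toReal) *
        (1 / (1 - ‖(φ z : ℂ)‖ ^ 2)) ^ (1 / p.toReal) := by
    rw [← Real.mul_rpow (mul_nonneg (by norm_num) (div_nonneg (by linarith) hz.le))
      (by positivity)]
    refine Real.rpow_le_rpow (by positivity) ?_ hq
    rw [← mul_div_assoc 8, div_mul_div_comm, div_le_div_iff₀ hz (mul_pos hz hw)]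
    nlinarith [mul_nonneg hz.le (sq_nonneg (1 - ‖(φ z : ℂ)‖))]
  refine le_of_mul_le_mul_right (key.trans ?_) hpos
  calc _ ≤ _ := mul_le_mul_of_nonneg_right hle (norm_nonneg _)
    _ = _ := by ring

/-! ### Stolz domains and angular derivatives. -/

/-- Within a Stolz domain, points approaching the circle approach the vertex. -/
theorem comap_norm_inf_stolzDomain_le (ζ : Circle) (α : ℝ) :
    comap (fun z : 𝔻 => ‖(z : ℂ)‖) (𝓝[<] 1) ⊓ 𝓟 (stolzDomain ζ α) ≤
      comap (fun z : 𝔻 => (z : ℂ)) (𝓝 (ζ : ℂ)) ⊓ 𝓟 (stolzDomain ζ α) := by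
  refine le_inf ?_ inf_le_right
  rw [← tendsto_iff_comap, tendsto_iff_norm_sub_tendsto_zero]
  have h1 : Tendsto (fun z : 𝔻 => ‖(z : ℂ)‖)
      (comap (fun z : 𝔻 => ‖(z : ℂ)‖) (𝓝[<] 1) ⊓ 𝓟 (stolzDomain ζ α)) (𝓝 1) :=
    (tendsto_comap.mono_left inf_le_left).mono_right nhdsWithin_le_nhds
  have h2 : Tendsto (fun z : 𝔻 => α * (1 - ‖(z : ℂ)‖))
      (comap (fun z : 𝔻 => ‖(z : ℂ)‖) (𝓝[<] 1) ⊓ 𝓟 (stolzDomain ζ α)) (𝓝 0) := by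
    simpa using (h1.const_sub 1).const_mul α
  refine squeeze_zero' (Eventually.of_forall fun _ => norm_nonneg _) ?_ h2
  filter_upwards [mem_inf_of_right (mem_principal_self _)] with z hz
  rw [norm_sub_rev]
  exact le_of_lt hz

/-- A finite angular derivative bounds `|η - φ z|` by a multiple of `1 - |z|`. -/
theorem exists_norm_sub_le {φ : 𝔻 → 𝔻} {ζ : Circle} (hζ : HasFiniteAngularDerivative φ ζ)
    {α : ℝ} (hα : 1 < α) : ∃ (η : Circle) (M : ℝ),
      ∀ᶠ z in comap (fun z : 𝔻 => (z : ℂ)) (𝓝 (ζ : ℂ)) ⊓ 𝓟 (stolzDomain ζ α),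
        ‖(η : ℂ) - φ z‖ ≤ M * (1 - ‖(z : ℂ)‖) := by
  obtain ⟨η, l, hl⟩ := hζ
  -- Near `ζ` the quotient has modulus below `‖l‖ + 1`; the factor `α` converts |ζ - z| into 1 -
  -- |z|.
  refine ⟨η, (‖l‖ + 1) * α, ?_⟩
  filter_upwards [(hl α hα).norm.eventually_lt_const (lt_add_one ‖l‖),
    mem_inf_of_right (mem_principal_self _)] with z hz hzS
  have hne : (ζ : ℂ) - z ≠ 0 := by
    intro h0
    have := z.norm_lt_one
    rw [← sub_eq_zero.1 h0, Circle.norm_coe] at this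
    exact lt_irrefl _ this
  rw [norm_div, div_lt_iff₀ (norm_pos_iff.2 hne)] at hz
  rw [mul_assoc]
  exact hz.le.trans (mul_le_mul_of_nonneg_left (le_of_lt hzS) (by positivity))

theorem one_sub_norm_le {η : Circle} (w : ℂ) : 1 - ‖w‖ ≤ ‖(η : ℂ) - w‖ := by
  simpa only [Circle.norm_coe] using norm_sub_norm_le (η : ℂ) w

theorem eventually_norm_weight_le {p : ℝ≥0∞} [Fact (1 ≤ p)] (hp : p ≠ ∞) {h : 𝔻 → ℂ}
    {φ : 𝔻 → 𝔻} {T : HardySpace p →L[ℂ] HardySpace p}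
    (hT : ∀ f : HardySpace p, (T f : 𝔻 → ℂ) = weightedComp h φ f) {ζ : Circle}
    (hζ : HasFiniteAngularDerivative φ ζ) {α : ℝ} (hα : 1 < α) :
    ∃ M : ℝ, ∀ᶠ z in comap (fun z : 𝔻 => (z : ℂ)) (𝓝 (ζ : ℂ)) ⊓ 𝓟 (stolzDomain ζ α),
      ‖h z‖ ≤ M * ‖T (hardyKernel p hp (φ z))‖ := by
  obtain ⟨η, M, hM⟩ := exists_norm_sub_le hζ hα
  refine ⟨(8 * M) ^ (1 / p.toReal), hM.mono fun z hz => ?_⟩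
  have hz1 : 0 < 1 - ‖(z : ℂ)‖ := sub_pos.2 z.norm_lt_one
  have hw1 : 0 < 1 - ‖(φ z : ℂ)‖ := sub_pos.2 (φ z).norm_lt_one
  refine (norm_weight_le hp hT z).trans ?_
  gcongr
  rw [div_le_iff₀ hz1]
  exact (one_sub_norm_le (φ z : ℂ)).trans hz

theorem exists_bound_of_norm_le {f : 𝔻 → ℂ} (hf : IsHolomorphic f) {r : ℝ} (hr : r < 1) :
    ∃ C : ℝ, ∀ z : 𝔻, ‖(z : ℂ)‖ ≤ r → ‖f z‖ ≤ C := by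
  obtain ⟨C, hC⟩ := (isCompact_closedBall (0 : ℂ) r).exists_bound_of_continuousOn
    (hf.continuousOn.mono (Metric.closedBall_subset_ball hr))
  exact ⟨C, fun z hz => by simpa [zeroExt_coe] using hC z (by simpa using hz)⟩

/-- Points of the Stolz domain at distance at least ε from the vertex satisfy |z| < 1 - ε/α, so they
lie in a compact disc. -/
theorem exists_bound_on_stolzDomain {f : 𝔻 → ℂ} (hf : IsHolomorphic f) {ζ : Circle} {α : ℝ}
    (hα : 1 < α) {C : ℝ}
    (hC : ∀ᶠ z in comap (fun z : 𝔻 => (z : ℂ)) (𝓝 (ζ : ℂ)) ⊓ 𝓟 (stolzDomain ζ α),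
      ‖f z‖ ≤ C) :
    ∃ C : ℝ, ∀ z ∈ stolzDomain ζ α, ‖f z‖ ≤ C := by
  rw [eventually_inf_principal, eventually_comap, Metric.eventually_nhds_iff] at hC
  obtain ⟨ε, hε, hC⟩ := hC
  have hα0 : 0 < α := zero_lt_one.trans hα
  obtain ⟨C', hC'⟩ := exists_bound_of_norm_le hf (r := 1 - ε / α)
    (by linarith [div_pos hε hα0])
  refine ⟨max C C', fun z hz => ?_⟩
  rcases lt_or_ge ‖(ζ : ℂ) - z‖ ε with hlt | hge
  · exact (hC (y := (z : ℂ)) (by rwa [dist_eq_norm, norm_sub_rev]) z rfl hz).trans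
      (le_max_left _ _)
  · refine (hC' z ?_).trans (le_max_right _ _)
    have h1 : ε < α * (1 - ‖(z : ℂ)‖) := hge.trans_lt hz
    have h2 : ε / α < 1 - ‖(z : ℂ)‖ := by
      rw [div_lt_iff₀ hα0]; linarith
    linarith

/-! ### Compactness and norm convergence. -/

theorem continuous_apply {p : ℝ≥0∞} [Fact (1 ≤ p)] (hp : p ≠ ∞) (z : 𝔻) :
    Continuous fun f : HardySpace p => f z := by
  let ev : HardySpace p →ₗ[ℂ] ℂ :=
    { toFun := fun f => f z, map_add' := fun _ _ => rfl, map_smul' := fun _ _ => rfl }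
  exact (ev.mkContinuous _ (norm_apply_le hp · z)).continuous

/-- The numerator 1 - |w|² vanishes in the limit, while the denominator does not, because |η̄u| =
|u| < 1. -/
theorem tendsto_kernelPower {p : ℝ≥0∞} [h1 : Fact (1 ≤ p)] (hp : p ≠ ∞) {ι : Type*}
    {L : Filter ι} {w : ι → 𝔻} {η : Circle} (hw : Tendsto (fun i => (w i : ℂ)) L (𝓝 η))
    (u : 𝔻) : Tendsto (fun i => kernelPower p (w i) u) L (𝓝 0) := by
  have hq : 0 < 1 / p.toReal :=
    one_div_pos.2 (ENNReal.toReal_pos (zero_lt_one.trans_le h1.out).ne' hp)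
  rw [tendsto_zero_iff_norm_tendsto_zero]
  simp only [norm_kernelPower]
  have hne : ‖1 - conj (η : ℂ) * u‖ ^ 2 ≠ 0 := by
    refine pow_ne_zero 2 (norm_ne_zero_iff.2 fun h0 => ?_)
    have h2 : ‖conj (η : ℂ) * u‖ = 1 := by rw [← sub_eq_zero.1 h0, norm_one]
    rw [norm_mul, RCLike.norm_conj, Circle.norm_coe, one_mul] at h2
    exact u.norm_lt_one.ne h2
  have hnum : Tendsto (fun i => 1 - ‖(w i : ℂ)‖ ^ 2) L (𝓝 0) := by
    have := (hw.norm.pow 2).const_sub 1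
    rwa [Circle.norm_coe, one_pow, sub_self] at this
  have hden : Tendsto (fun i => ‖1 - conj (w i : ℂ) * u‖ ^ 2) L
      (𝓝 (‖1 - conj (η : ℂ) * u‖ ^ 2)) :=
    ((((Complex.continuous_conj.tendsto _).comp hw).mul_const (u : ℂ)).const_sub 1).norm.pow 2
  have := (hnum.div hden hne).rpow_const (p := 1 / p.toReal) (Or.inr hq.le)
  rwa [zero_div, Real.zero_rpow hq.ne'] at this

/-- A compact weighted composition operator sends kernels at points tending to the circle to
functions tending to zero in norm. -/
theorem tendsto_apply_hardyKernel {p : ℝ≥0∞} [Fact (1 ≤ p)] (hp : p ≠ ∞) {h : 𝔻 → ℂ}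
    {φ : 𝔻 → 𝔻} {T : HardySpace p →L[ℂ] HardySpace p}
    (hT : ∀ f : HardySpace p, (T f : 𝔻 → ℂ) = weightedComp h φ f)
    (hTc : IsCompactOperator T) {ι : Type*} {L : Filter ι} {w : ι → 𝔻} {η : Circle}
    (hw : Tendsto (fun i => (w i : ℂ)) L (𝓝 η)) :
    Tendsto (fun i => T (hardyKernel p hp (w i))) L (𝓝 0) := by
  obtain ⟨K, hK, hsub⟩ := IsCompactOperator.image_closedBall_subset_compact
    (f := (T : HardySpace p →ₗ[ℂ] HardySpace p)) hTc 1
  -- Inside the compact set `K` it suffices that 0 is the only cluster point; continuous point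
  -- evaluations identify a cluster point with the pointwise limit.
  refine hK.tendsto_nhds_of_unique_mapClusterPt (Eventually.of_forall fun i => hsub
    ⟨_, by simpa using norm_hardyKernel_le hp (w i), rfl⟩) fun g _ hg => ?_
  refine Subtype.ext (funext fun u => ?_)
  have h1 : MapClusterPt (g.1 u) L (fun i => (T (hardyKernel p hp (w i)) : 𝔻 → ℂ) u) :=
    hg.continuousAt_comp (continuous_apply hp u).continuousAt
  have h2 : Tendsto (fun i => (T (hardyKernel p hp (w i)) : 𝔻 → ℂ) u) L (𝓝 0) := by
    have : ∀ i, (T (hardyKernel p hp (w i)) : 𝔻 → ℂ) u = h u * kernelPower p (w i) (φ u) :=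
      fun i => by rw [hT]; rfl
    simp only [this]
    simpa using (tendsto_kernelPower hp hw (φ u)).const_mul (h u)
  have : (𝓝 (g.1 u) ⊓ 𝓝 (0 : ℂ)).NeBot := h1.clusterPt.neBot.mono (inf_le_inf_left _ h2)
  exact eq_of_nhds_neBot this

end WeightedComposition

theorem mainTheorem6 (φ : 𝔻 → 𝔻)
    (hφ : WeightedComposition.IsHolomorphic (fun z => (φ z : ℂ)))
    (p : ℝ≥0∞) [Fact (1 ≤ p)] (hp : p ≠ ∞)
    (h : WeightedComposition.HardySpace p) :
    (WeightedComposition.IsBoundedOnHardy p h φ →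
      ∀ ζ ∈ WeightedComposition.angularDerivativeSet φ, ∀ α : ℝ, 1 < α →
        ∃ C : ℝ, ∀ z ∈ WeightedComposition.stolzDomain ζ α, ‖h z‖ ≤ C) ∧
    (WeightedComposition.IsCompactOnHardy p h φ →
      ∀ ζ ∈ WeightedComposition.angularDerivativeSet φ, ∀ α : ℝ, 1 < α →
        Tendsto (fun z : 𝔻 => h z)
          (comap (fun z : 𝔻 => ‖(z : ℂ)‖) (𝓝[<] 1) ⊓
            𝓟 (WeightedComposition.stolzDomain ζ α)) (𝓝 0)) := by
  open WeightedComposition in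
  refine ⟨fun ⟨T, hT⟩ ζ hζ α hα => ?_, fun ⟨T, hT, hTc⟩ ζ hζ α hα => ?_⟩
  · obtain ⟨M, hM⟩ := eventually_norm_weight_le hp hT hζ hα
    -- The sign of `M` is not recorded, hence `|M|`.
    refine exists_bound_on_stolzDomain h.2.1 hα (C := |M| * ‖T‖) (hM.mono fun z hz => ?_)
    refine hz.trans (mul_le_mul (le_abs_self M) ?_ (norm_nonneg _) (abs_nonneg _))
    exact T.unit_le_opNorm _ (norm_hardyKernel_le hp _)
  · have hL := comap_norm_inf_stolzDomain_le ζ α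
    obtain ⟨M, hM⟩ := eventually_norm_weight_le hp hT hζ hα
    obtain ⟨η, M', hM'⟩ := exists_norm_sub_le hζ hα
    have h0 : Tendsto (fun z : 𝔻 => 1 - ‖(z : ℂ)‖) (comap (fun z : 𝔻 => ‖(z : ℂ)‖) (𝓝[<] 1) ⊓
        𝓟 (stolzDomain ζ α)) (𝓝 0) := by
      have h1 : Tendsto (fun z : 𝔻 => ‖(z : ℂ)‖) (comap (fun z : 𝔻 => ‖(z : ℂ)‖) (𝓝[<] 1) ⊓
          𝓟 (stolzDomain ζ α)) (𝓝 1) :=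
        (tendsto_comap.mono_left inf_le_left).mono_right nhdsWithin_le_nhds
      simpa using h1.const_sub 1
    have hw : Tendsto (fun z => (φ z : ℂ)) (comap (fun z : 𝔻 => ‖(z : ℂ)‖) (𝓝[<] 1) ⊓
        𝓟 (stolzDomain ζ α)) (𝓝 η) := by
      rw [tendsto_iff_norm_sub_tendsto_zero]
      refine squeeze_zero' (Eventually.of_forall fun _ => norm_nonneg _) ?_
        (by simpa using h0.const_mul M')
      filter_upwards [hL hM'] with z hz
      rwa [norm_sub_rev]
    have hT0 := (tendsto_apply_hardyKernel hp hT hTc hw).norm.const_mul M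
    rw [norm_zero, mul_zero] at hT0
    exact squeeze_zero_norm' (hL hM) hT0
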